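/- Let $K$ be an algebraically closed field of characteristic $p>0$, let $n\in\mathbb{N}$, and let $K[\mathfrak{gl}_n]$ be the algebra of polynomial functions on the space $\mathfrak{gl}_n$ of $n\times n$ matrices over $K$. The Lie algebra $\mathfrak{gl}_n$ acts on $K[\mathfrak{gl}_n]$ by the derivations that extend the coadjoint action $(x\cdot\xi)(y)=-\xi([x,y])$ on linear functions $\xi\in\mathfrak{gl}_n^*$. For a Lie subalgebra $L\subseteq\mathfrak{gl}_n$ put $K[\mathfrak{gl}_n]^{L}=\{f\in K[\mathfrak{gl}_n] : x\cdot f=0\text{ for all }x\in L\}$, and let $\mathfrak{sl}_n$ be the Lie subalgebra of matrices of trace $0$. Then $$K[\mathfrak{gl}_n]^{\mathfrak{gl}_n}=K[\mathfrak{gl}_n]^{\mathfrak{sl}_n}.$$ Moreover, $K[\mathfrak{gl}_n]^{\mathfrak{gl}_n}$ is a unique factorisation domain, and its irreducible elements are precisely the $p$th powers of the irreducible elements of $K[\mathfrak{gl}_n]$ that are not invariant under $\mathfrak{gl}_n$, together with the irreducible elements of $K[\mathfrak{gl}_n]$ that are contained in $K[\mathfrak{gl}_n]^{\mathfrak{gl}_n}$.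 (No restriction is placed on $p$ and $n$: the cases $p\mid n$ and $(p,n)=(2,2)$ are included.) -/

import Mathlib

attribute [local instance 100] LieRing.ofAssociativeRing

namespace GLInvariants

open MvPolynomial Matrix

/-- The coordinate algebra `K[gl_n]` of the affine space of `n × n` matrices over `K`:
the variable indexed by `(i, j)` is the `(i, j)`-th coordinate function. -/
abbrev CoordRing (K : Type*) [Field K] (n : ℕ) : Type _ :=
  MvPolynomial (Fin n × Fin n) K

/-- The derivation of `K[gl_n]` by which `x ∈ gl_n` acts. It is the derivation extending the
coadjoint action `(x • ξ)(y) = -ξ([x, y])` on linear functions `ξ`: if `Y` is the generic matrix,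
whose entries are the coordinate functions, then the coordinate function `Y i j` is sent to the
`(i, j)`-th entry of `-[x, Y] = -(x * Y - Y * x)`. -/
noncomputable def coadDerivation {K : Type*} [Field K] {n : ℕ} (x : Matrix (Fin n) (Fin n) K) :
    Derivation K (CoordRing K n) (CoordRing K n) :=
  mkDerivation K fun ij =>
    (-(x.map C * mvPolynomialX (Fin n) (Fin n) K
      - mvPolynomialX (Fin n) (Fin n) K * x.map C) :
      Matrix (Fin n) (Fin n) (CoordRing K n)) ij.1 ij.2

theorem coadDerivation_X {K : Type*} [Field K] {n : ℕ} (x : Matrix (Fin n) (Fin n) K)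
    (i j : Fin n) :
    coadDerivation x (X (i, j)) =
      (∑ k, C (x k j) * X (i, k)) - ∑ k, C (x i k) * X (k, j) := by
  simp [coadDerivation, mkDerivation_X, Matrix.mul_apply, mul_comm]

/-- The action of the Lie algebra `gl_n` on `K[gl_n]` by derivations. -/
noncomputable def coadAction (K : Type*) [Field K] (n : ℕ) :
    Matrix (Fin n) (Fin n) K →ₗ⁅K⁆ Derivation K (CoordRing K n) (CoordRing K n) where
  toFun := coadDerivation
  map_add' x y := by
    refine derivation_ext fun ij => ?_
    obtain ⟨i, j⟩ := ij
    simp only [Derivation.add_apply, coadDerivation_X, Matrix.add_apply, map_add, add_mul,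
      Finset.sum_add_distrib]
    ring
  map_smul' c x := by
    refine derivation_ext fun ij => ?_
    obtain ⟨i, j⟩ := ij
    simp only [Derivation.smul_apply, coadDerivation_X, Matrix.smul_apply, smul_eq_mul, map_mul,
      mul_assoc, RingHom.id_apply, smul_sub, Finset.smul_sum, smul_eq_C_mul]
  map_lie' {x y} := by
    refine derivation_ext fun ij => ?_
    obtain ⟨i, j⟩ := ij
    have hC : ∀ (z : Matrix (Fin n) (Fin n) K) (a : K), coadDerivation z (C a) = 0 :=
      fun z a => Derivation.map_algebraMap _ a
    simp only [Derivation.commutator_apply, coadDerivation_X, map_sub, map_sum,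
      Derivation.leibniz, hC, smul_eq_mul, mul_zero, add_zero, LieRing.of_associative_ring_bracket,
      Matrix.sub_apply, Matrix.mul_apply, map_mul, sub_mul, mul_sub, Finset.sum_mul,
      Finset.mul_sum, Finset.sum_sub_distrib]
    have e1 : ∀ a b : Matrix (Fin n) (Fin n) K,
        (∑ k, ∑ l, C (a k j) * (C (b l k) * X (i, l)) : CoordRing K n)
          = ∑ k, ∑ l, C (b k l) * C (a l j) * X (i, k) := by
      intro a b
      rw [Finset.sum_comm]
      exact Finset.sum_congr rfl fun _ _ => Finset.sum_congr rfl fun _ _ => by ring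
    have e2 : ∀ a b : Matrix (Fin n) (Fin n) K,
        (∑ k, ∑ l, C (a i k) * (C (b k l) * X (l, j)) : CoordRing K n)
          = ∑ k, ∑ l, C (a i l) * C (b l k) * X (k, j) := by
      intro a b
      rw [Finset.sum_comm]
      exact Finset.sum_congr rfl fun _ _ => Finset.sum_congr rfl fun _ _ => by ring
    have e3 : ∀ a b : Matrix (Fin n) (Fin n) K,
        (∑ k, ∑ l, C (a k j) * (C (b i l) * X (l, k)) : CoordRing K n)
          = ∑ k, ∑ l, C (b i k) * (C (a l j) * X (k, l)) := by
      intro a b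
      rw [Finset.sum_comm]
      exact Finset.sum_congr rfl fun _ _ => Finset.sum_congr rfl fun _ _ => by ring
    rw [e1, e1, e2, e2, e3, e3]
    ring

/-- The algebra `K[gl_n]^L` of invariants of a Lie subalgebra `L` of `gl_n`: the functions that
are annihilated by every element of `L`. -/
def invariants {K : Type*} [Field K] {n : ℕ} (L : LieSubalgebra K (Matrix (Fin n) (Fin n) K)) :
    Subalgebra K (CoordRing K n) where
  carrier := {f | ∀ x ∈ L, coadAction K n x f = 0}
  mul_mem' {f g} hf hg x hx := by simp [hf x hx, hg x hx]
  add_mem' {f g} hf hg x hx := by simp [hf x hx, hg x hx]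
  algebraMap_mem' c x _ := Derivation.map_algebraMap _ c

end GLInvariants

namespace GLInvariants

open MvPolynomial Matrix

section

/-! ### Invariance under commutators -/

variable {K : Type*} [Field K] {n : ℕ}

/-! The generic matrix `Y` commutes with itself, so `∑ Y i j • E i j` acts as zero. If commutators
kill `f`, the off-diagonal `E i j` kill `f` and all `E i i` act on it alike, so the relation reads
`tr Y * (E i i • f) = 0`; hence `f` is invariant, whether or not `p ∣ n`
(`mem_invariants_top_of_lie`). By degree, a polynomial dividing all its derivatives is an
eigenvector with a character as eigenvalue. Commutators kill it, so it is invariant. Hence a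
noninvariant irreducible occurs in an invariant with multiplicity divisible by `p`
(`pow_char_dvd_of_dvd`), and the listed elements are primes dividing every nonzero nonunit
invariant. -/

theorem mem_invariants_top {f : CoordRing K n} :
    f ∈ invariants (⊤ : LieSubalgebra K (Matrix (Fin n) (Fin n) K)) ↔
      ∀ x, coadDerivation x f = 0 :=
  ⟨fun h x => h x trivial, fun h x _ => h x⟩

theorem coadDerivation_lie (x y : Matrix (Fin n) (Fin n) K) (f : CoordRing K n) :
    coadDerivation ⁅x, y⁆ f =
      coadDerivation x (coadDerivation y f) - coadDerivation y (coadDerivation x f) := by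
  have h := congrArg (fun D => D f) ((coadAction K n).map_lie x y)
  rwa [Derivation.commutator_apply] at h

theorem sum_derivation_apply {ι : Type*} (s : Finset ι)
    (D : ι → Derivation K (CoordRing K n) (CoordRing K n)) (f : CoordRing K n) :
    (∑ i ∈ s, D i) f = ∑ i ∈ s, D i f := by
  have h := map_sum (Derivation.coeFnAddMonoidHom (R := K) (A := CoordRing K n)
    (M := CoordRing K n)) D s
  exact (congrFun h f).trans (Finset.sum_apply _ _ _)

/-- The generic matrix commutes with itself, so its entries give a linear relation between the
derivations by which the elementary matrices act. -/
theorem sum_X_smul_coadDerivation_single :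
    (∑ i : Fin n, ∑ j : Fin n, (X (i, j) : CoordRing K n) •
      coadDerivation (Matrix.single i j (1 : K))) = 0 := by
  refine derivation_ext fun ab => ?_
  obtain ⟨a, b⟩ := ab
  simp only [sum_derivation_apply, Derivation.smul_apply, smul_eq_mul,
    coadDerivation_X, Derivation.zero_apply, mul_sub, Finset.sum_sub_distrib, Matrix.single_apply]
  rw [sub_eq_zero]
  have h1 : ∀ i j : Fin n, (∑ k, (C (if i = k ∧ j = b then (1 : K) else 0) * X (a, k) :
      CoordRing K n)) = if j = b then X (a, i) else 0 := fun i j => by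
    by_cases h : j = b <;> simp [h, apply_ite C]
  have h2 : ∀ i j : Fin n, (∑ k, (C (if i = a ∧ j = k then (1 : K) else 0) * X (k, b) :
      CoordRing K n)) = if i = a then X (j, b) else 0 := fun i j => by
    by_cases h : i = a <;> simp [h, apply_ite C]
  simp only [h1, h2, mul_ite, mul_zero]
  rw [Finset.sum_comm (f := fun i j => if i = a then
    (X (i, j) * X (j, b) : CoordRing K n) else 0)]
  simp [mul_comm]

theorem mem_invariants_top_of_lie {f : CoordRing K n}
    (hf : ∀ x y : Matrix (Fin n) (Fin n) K, coadDerivation ⁅x, y⁆ f = 0) :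
    f ∈ invariants (⊤ : LieSubalgebra K (Matrix (Fin n) (Fin n) K)) := by
  have hoff : ∀ i j : Fin n, i ≠ j → coadDerivation (Matrix.single i j (1 : K)) f = 0 := by
    intro i j hij
    -- `[E i i, E i j] = E i j` for `i ≠ j`.
    have h := hf (Matrix.single i i 1) (Matrix.single i j 1)
    rwa [LieRing.of_associative_ring_bracket, Matrix.single_mul_single_same,
      Matrix.single_mul_single_of_ne (h := hij.symm), sub_zero, mul_one] at h
  have hdiag : ∀ i j : Fin n, coadDerivation (Matrix.single i i (1 : K)) f =
      coadDerivation (Matrix.single j j (1 : K)) f := by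
    intro i j
    have h := hf (Matrix.single i j 1) (Matrix.single j i 1)
    rw [LieRing.of_associative_ring_bracket, Matrix.single_mul_single_same,
      Matrix.single_mul_single_same, mul_one] at h
    have h' := (coadAction K n).map_sub (Matrix.single i i 1) (Matrix.single j j 1)
    have h'' := congrArg (fun D => D f) h'
    rw [Derivation.sub_apply] at h''
    exact sub_eq_zero.mp (h''.symm.trans h)
  have hsingle : ∀ i j : Fin n, coadDerivation (Matrix.single i j (1 : K)) f = 0 := by
    intro i j
    by_cases hij : i = j
    · subst hij
      have h := congrArg (fun D => D f) (sum_X_smul_coadDerivation_single (K := K) (n := n))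
      simp only [sum_derivation_apply, Derivation.smul_apply, smul_eq_mul,
        Derivation.zero_apply] at h
      have h2 : ∀ a : Fin n, ∑ b, X (a, b) * coadDerivation (Matrix.single a b (1 : K)) f =
          X (a, a) * coadDerivation (Matrix.single i i (1 : K)) f := by
        intro a
        rw [Finset.sum_eq_single a (fun b _ hb => by rw [hoff a b hb.symm, mul_zero])
          (by simp), hdiag a i]
      rw [Finset.sum_congr rfl fun a _ => h2 a, ← Finset.sum_mul] at h
      refine (mul_eq_zero.mp h).resolve_left fun h0 => ?_
      -- The trace is a nonzero polynomial: at the matrix `E i i` it equals 1, even when `p ∣ n`.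
      have h3 := congrArg (eval fun ab : Fin n × Fin n => if ab = (i, i) then (1 : K) else 0) h0
      simp [Prod.ext_iff] at h3
    · exact hoff i j hij
  rw [mem_invariants_top]
  intro x
  have hx : coadAction K n x f = 0 := by
    rw [Matrix.matrix_eq_sum_single x]
    simp only [map_sum, sum_derivation_apply]
    refine Finset.sum_eq_zero fun i _ => Finset.sum_eq_zero fun j _ => ?_
    rw [← mul_one (x i j), ← smul_eq_mul, ← Matrix.smul_single, map_smul, Derivation.smul_apply]
    exact (congrArg _ (hsingle i j)).trans (smul_zero _)
  exact hx

theorem invariants_top_eq_invariants_sl :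
    invariants (⊤ : LieSubalgebra K (Matrix (Fin n) (Fin n) K)) =
      invariants (LieAlgebra.SpecialLinear.sl (Fin n) K) := by
  refine le_antisymm (fun f hf x _ => hf x trivial) fun f hf => ?_
  refine mem_invariants_top_of_lie fun x y => hf _ ?_
  have : Matrix.trace ⁅x, y⁆ = 0 := by
    rw [LieRing.of_associative_ring_bracket, Matrix.trace_sub, Matrix.trace_mul_comm, sub_self]
  exact this

/-! ### Semi-invariants and divisibility -/

theorem totalDegree_coadDerivation_le (x : Matrix (Fin n) (Fin n) K) (f : CoordRing K n) :
    (coadDerivation x f).totalDegree ≤ f.totalDegree := by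
  have hX : ∀ ij : Fin n × Fin n, (coadDerivation x (X ij)).totalDegree ≤ 1 := by
    rintro ⟨i, j⟩
    rw [coadDerivation_X]
    refine (totalDegree_sub _ _).trans (max_le ?_ ?_) <;>
    · refine totalDegree_finsetSum_le fun k _ => (totalDegree_mul _ _).trans ?_
      simp
  have hmon : ∀ (s : Fin n × Fin n →₀ ℕ) (c : K),
      (coadDerivation x (monomial s c)).totalDegree ≤ s.sum fun _ k => k := by
    intro s c
    rw [coadDerivation, mkDerivation_monomial]
    refine (totalDegree_smul_le _ _).trans (totalDegree_finsetSum_le fun i hi => ?_)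
    refine (totalDegree_mul _ _).trans ?_
    have h1 := hX i
    rw [coadDerivation, mkDerivation_X] at h1
    refine (add_le_add (totalDegree_monomial_le _ _) h1).trans ?_
    have hs : (s - Finsupp.single i 1) + Finsupp.single i 1 = s :=
      tsub_add_cancel_of_le (Finsupp.single_le_iff.mpr
        (Nat.one_le_iff_ne_zero.mpr (Finsupp.mem_support_iff.mp hi)))
    conv_rhs => rw [← hs, Finsupp.sum_add_index' (by simp) (by simp)]
    simp [Finsupp.sum]
  conv_lhs => rw [f.as_sum, map_sum]
  exact totalDegree_finsetSum_le fun s hs => (hmon s _).trans (le_totalDegree hs)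

theorem exists_coadDerivation_eq_C_mul {x : Matrix (Fin n) (Fin n) K} {g : CoordRing K n}
    (h : g ∣ coadDerivation x g) : ∃ c : K, coadDerivation x g = C c * g := by
  obtain ⟨q, hq⟩ := h
  by_cases h0 : coadDerivation x g = 0
  · exact ⟨0, by rw [h0, C_0, zero_mul]⟩
  · have hg : g ≠ 0 := by rintro rfl; simp at h0
    have hq0 : q ≠ 0 := by rintro rfl; simp [hq] at h0
    have hd := totalDegree_coadDerivation_le x g
    rw [hq, totalDegree_mul_of_isDomain hg hq0] at hd
    have hq1 : q.totalDegree = 0 := by omega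
    rw [totalDegree_eq_zero_iff_eq_C] at hq1
    exact ⟨_, by rw [hq, mul_comm, ← hq1]⟩

theorem mem_invariants_top_of_dvd {g : CoordRing K n}
    (h : ∀ x : Matrix (Fin n) (Fin n) K, g ∣ coadDerivation x g) :
    g ∈ invariants (⊤ : LieSubalgebra K (Matrix (Fin n) (Fin n) K)) := by
  choose c hc using fun x => exists_coadDerivation_eq_C_mul (h x)
  refine mem_invariants_top_of_lie fun x y => ?_
  have hC : ∀ (z : Matrix (Fin n) (Fin n) K) (a : K), coadDerivation z (C a) = 0 :=
    fun z a => Derivation.map_algebraMap _ a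
  rw [coadDerivation_lie, hc y, hc x, Derivation.leibniz, Derivation.leibniz, hC, hC, hc x, hc y]
  simp only [smul_eq_mul, mul_zero, add_zero]
  ring

theorem mem_invariants_top_of_mul_mem {g q : CoordRing K n} (hg0 : g ≠ 0)
    (hg : g ∈ invariants (⊤ : LieSubalgebra K (Matrix (Fin n) (Fin n) K)))
    (h : g * q ∈ invariants (⊤ : LieSubalgebra K (Matrix (Fin n) (Fin n) K))) :
    q ∈ invariants (⊤ : LieSubalgebra K (Matrix (Fin n) (Fin n) K)) := by
  rw [mem_invariants_top] at *
  intro x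
  have h1 := h x
  rw [Derivation.leibniz, hg x, smul_zero, add_zero, smul_eq_mul] at h1
  exact (mul_eq_zero.mp h1).resolve_left hg0

/-- The quotient of an invariant by a nonzero invariant is again invariant, so primality of
invariants can be tested in the polynomial ring. -/
theorem dvd_iff_coe_dvd
    {f g : invariants (⊤ : LieSubalgebra K (Matrix (Fin n) (Fin n) K))} :
    g ∣ f ↔ (g : CoordRing K n) ∣ f := by
  refine ⟨fun ⟨q, hq⟩ => ⟨q, by rw [hq]; rfl⟩, fun ⟨q, hq⟩ => ?_⟩
  by_cases hg0 : (g : CoordRing K n) = 0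
  · have : f = g := Subtype.ext (by rw [hq, hg0, zero_mul])
    rw [this]
  · exact ⟨⟨q, mem_invariants_top_of_mul_mem hg0 g.2 (hq ▸ f.2)⟩, Subtype.ext hq⟩

theorem isUnit_iff_isUnit_coe
    {f : invariants (⊤ : LieSubalgebra K (Matrix (Fin n) (Fin n) K))} :
    IsUnit f ↔ IsUnit (f : CoordRing K n) := by
  rw [isUnit_iff_dvd_one, dvd_iff_coe_dvd, isUnit_iff_dvd_one]
  rfl

theorem prime_of_irreducible_coe
    {f : invariants (⊤ : LieSubalgebra K (Matrix (Fin n) (Fin n) K))}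
    (hf : Irreducible (f : CoordRing K n)) : Prime f := by
  refine ⟨fun h => hf.ne_zero (by rw [h]; rfl), fun h => hf.not_isUnit
    (isUnit_iff_isUnit_coe.mp h), fun a b h => ?_⟩
  rw [dvd_iff_coe_dvd] at h
  simp only [dvd_iff_coe_dvd]
  exact hf.prime.dvd_or_dvd h

/-! ### Factorisation in characteristic `p` -/

section CharP

variable (p : ℕ) [CharP K p]

theorem pow_char_mem_invariants_top (g : CoordRing K n) :
    g ^ p ∈ invariants (⊤ : LieSubalgebra K (Matrix (Fin n) (Fin n) K)) := by
  rw [mem_invariants_top]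
  intro x
  rw [Derivation.leibniz_pow, ← Nat.cast_smul_eq_nsmul (CoordRing K n), CharP.cast_eq_zero,
    zero_smul]

theorem pow_char_dvd_of_dvd {f g : CoordRing K n} (hg : Irreducible g)
    (hg' : g ∉ invariants (⊤ : LieSubalgebra K (Matrix (Fin n) (Fin n) K)))
    (hf : f ∈ invariants (⊤ : LieSubalgebra K (Matrix (Fin n) (Fin n) K)))
    (h : g ∣ f) : g ^ p ∣ f := by
  by_cases hf0 : f = 0
  · rw [hf0]; exact dvd_zero _
  obtain ⟨m, q, hgq, rfl⟩ := WfDvdMonoid.max_power_factor hf0 hg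
  rcases m with _ | m
  · rw [pow_zero, one_mul] at h
    exact absurd h hgq
  suffices hpm : p ∣ m + 1 from
    Dvd.dvd.mul_right (pow_dvd_pow g (Nat.le_of_dvd m.succ_pos hpm)) q
  by_contra hpm
  refine hg' (mem_invariants_top_of_dvd fun x => ?_)
  have hx := mem_invariants_top.mp hf x
  -- Differentiate `g ^ (m + 1) * q` and cancel `g ^ m`. As `m + 1` is invertible in `K` and `g ∤
  -- q`, `g` divides its own derivative.
  rw [Derivation.leibniz, Derivation.leibniz_pow, Nat.add_sub_cancel,
    ← Nat.cast_smul_eq_nsmul (CoordRing K n)] at hx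
  simp only [smul_eq_mul] at hx
  have hx' : g ^ m * (g * coadDerivation x q + q * (((m + 1 : ℕ) : CoordRing K n) *
      coadDerivation x g)) = 0 := by
    rw [← hx]; ring
  have hx2 := (mul_eq_zero.mp hx').resolve_left (pow_ne_zero _ hg.ne_zero)
  have hdvd : g ∣ q * (((m + 1 : ℕ) : CoordRing K n) * coadDerivation x g) :=
    ⟨-coadDerivation x q, by linear_combination hx2⟩
  have hunit : IsUnit ((m + 1 : ℕ) : CoordRing K n) := by
    rw [← map_natCast (C : K →+* CoordRing K n)]
    exact (IsUnit.mk0 _ fun h0 => hpm ((CharP.cast_eq_zero_iff K p _).mp h0)).map C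
  exact hunit.dvd_mul_left.mp ((hg.prime.dvd_or_dvd hdvd).resolve_left hgq)

theorem prime_of_coe_eq_pow_char [Fact p.Prime]
    {f : invariants (⊤ : LieSubalgebra K (Matrix (Fin n) (Fin n) K))} {g : CoordRing K n}
    (hg : Irreducible g)
    (hg' : g ∉ invariants (⊤ : LieSubalgebra K (Matrix (Fin n) (Fin n) K)))
    (hfg : (f : CoordRing K n) = g ^ p) : Prime f := by
  have hp : p ≠ 0 := (Fact.out : p.Prime).ne_zero
  refine ⟨fun h => pow_ne_zero p hg.ne_zero (by rw [← hfg, h]; rfl), fun h => ?_,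
    fun a b h => ?_⟩
  · rw [isUnit_iff_isUnit_coe, hfg, isUnit_pow_iff hp] at h
    exact hg.not_isUnit h
  · rw [dvd_iff_coe_dvd] at h
    simp only [dvd_iff_coe_dvd, hfg] at h ⊢
    exact (hg.prime.dvd_or_dvd ((dvd_pow_self g hp).trans h)).imp
      (pow_char_dvd_of_dvd p hg hg' a.2) (pow_char_dvd_of_dvd p hg hg' b.2)

/-- A nonzero nonunit invariant is divisible, in the ring of invariants, by an irreducible
polynomial that is invariant or by the `p`th power of one that is not. -/
theorem exists_dvd_of_not_isUnit
    {f : invariants (⊤ : LieSubalgebra K (Matrix (Fin n) (Fin n) K))}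
    (hf0 : f ≠ 0) (hf : ¬ IsUnit f) :
    ∃ h : invariants (⊤ : LieSubalgebra K (Matrix (Fin n) (Fin n) K)), h ∣ f ∧
      ((∃ g : CoordRing K n, Irreducible g ∧
          g ∉ invariants (⊤ : LieSubalgebra K (Matrix (Fin n) (Fin n) K)) ∧
          (h : CoordRing K n) = g ^ p) ∨ Irreducible (h : CoordRing K n)) := by
  obtain ⟨g, hg, hgf⟩ := WfDvdMonoid.exists_irreducible_factor
    (a := (f : CoordRing K n)) (fun h => hf (isUnit_iff_isUnit_coe.mpr h))
    (fun h => hf0 (Subtype.ext h))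
  by_cases hg' : g ∈ invariants (⊤ : LieSubalgebra K (Matrix (Fin n) (Fin n) K))
  · exact ⟨⟨g, hg'⟩, dvd_iff_coe_dvd.mpr hgf, Or.inr hg⟩
  · exact ⟨⟨g ^ p, pow_char_mem_invariants_top p g⟩,
      dvd_iff_coe_dvd.mpr (pow_char_dvd_of_dvd p hg hg' f.2 hgf), Or.inl ⟨g, hg, hg', rfl⟩⟩

theorem prime_of_irreducible_or_pow_char [Fact p.Prime]
    {f : invariants (⊤ : LieSubalgebra K (Matrix (Fin n) (Fin n) K))}
    (h : (∃ g : CoordRing K n, Irreducible g ∧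
        g ∉ invariants (⊤ : LieSubalgebra K (Matrix (Fin n) (Fin n) K)) ∧
        (f : CoordRing K n) = g ^ p) ∨ Irreducible (f : CoordRing K n)) : Prime f := by
  rcases h with ⟨g, hg, hg', hfg⟩ | hf
  · exact prime_of_coe_eq_pow_char p hg hg' hfg
  · exact prime_of_irreducible_coe hf

theorem uniqueFactorizationMonoid_invariants_top [Fact p.Prime] :
    UniqueFactorizationMonoid
      (invariants (⊤ : LieSubalgebra K (Matrix (Fin n) (Fin n) K))) := by
  refine UniqueFactorizationMonoid.of_exists_prime_factors fun f => ?_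
  -- Strict divisibility is taken in the polynomial ring, where it is known to be well founded.
  have hwf := InvImage.wf
    (Subtype.val : invariants (⊤ : LieSubalgebra K (Matrix (Fin n) (Fin n) K)) → CoordRing K n)
    (IsWellFounded.wf (r := DvdNotUnit (α := CoordRing K n)))
  induction f using hwf.induction with
  | _ f ih =>
    intro hf0
    by_cases hfu : IsUnit f
    · exact ⟨0, by simp, by
        rw [Multiset.prod_zero]; exact (associated_one_iff_isUnit.mpr hfu).symm⟩
    obtain ⟨h, ⟨q, rfl⟩, hh⟩ := exists_dvd_of_not_isUnit p hf0 hfu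
    have hprime := prime_of_irreducible_or_pow_char p hh
    have hq0 : q ≠ 0 := right_ne_zero_of_mul hf0
    obtain ⟨s, hs, hsq⟩ := ih q ⟨fun h0 => hq0 (Subtype.ext h0), h,
      fun hu => hprime.not_isUnit (isUnit_iff_isUnit_coe.mpr hu), mul_comm _ _⟩ hq0
    refine ⟨h ::ₘ s, fun b hb => ?_, ?_⟩
    · rcases Multiset.mem_cons.mp hb with rfl | hb
      · exact hprime
      · exact hs b hb
    · rw [Multiset.prod_cons]
      exact hsq.mul_left h

theorem irreducible_iff_irreducible_or_pow_char [Fact p.Prime] [IsAlgClosed K]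
    (f : invariants (⊤ : LieSubalgebra K (Matrix (Fin n) (Fin n) K))) :
    Irreducible f ↔
      (∃ g : CoordRing K n, Irreducible g ∧
          g ∉ invariants (⊤ : LieSubalgebra K (Matrix (Fin n) (Fin n) K)) ∧
          (f : CoordRing K n) = g ^ p) ∨ Irreducible (f : CoordRing K n) := by
  refine ⟨fun hf => ?_, fun h => (prime_of_irreducible_or_pow_char p h).irreducible⟩
  obtain ⟨h, ⟨q, rfl⟩, hh⟩ := exists_dvd_of_not_isUnit p hf.ne_zero hf.not_isUnit
  have hprime := prime_of_irreducible_or_pow_char p hh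
  have hq : IsUnit (q : CoordRing K n) := isUnit_iff_isUnit_coe.mp
    ((hf.isUnit_or_isUnit rfl).resolve_left hprime.not_isUnit)
  rcases hh with ⟨g, hg, hg', hhg⟩ | hh
  · left
    obtain ⟨c, hc, hcq⟩ := MvPolynomial.isUnit_iff_eq_C_of_isReduced.mp hq
    -- The cofactor is a constant `c`; a `p`th root of it is absorbed into `g`, giving an exact
    -- `p`th power rather than an associate of one.
    obtain ⟨d, hd⟩ := IsAlgClosed.exists_pow_nat_eq c (Fact.out : p.Prime).pos
    have hd0 : d ≠ 0 := by
      rintro rfl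
      rw [zero_pow (Fact.out : p.Prime).ne_zero] at hd
      exact hc.ne_zero hd.symm
    have hdu : IsUnit (C d : CoordRing K n) := (IsUnit.mk0 d hd0).map C
    refine ⟨C d * g, (irreducible_isUnit_mul hdu).mpr hg, fun hmem => hg' ?_, ?_⟩
    · exact mem_invariants_top_of_mul_mem hdu.ne_zero
        (Subalgebra.algebraMap_mem _ d) hmem
    · rw [mul_pow, ← C_pow, hd, ← hcq, ← hhg, mul_comm]
      rfl
  · right
    exact (irreducible_mul_isUnit hq).mpr hh

end CharP

end

end GLInvariants

theorem lemma2 (K : Type*) [Field K] [IsAlgClosed K] (p : ℕ) [Fact p.Prime] [CharP K p] (n : ℕ) :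
    GLInvariants.invariants (⊤ : LieSubalgebra K (Matrix (Fin n) (Fin n) K)) =
        GLInvariants.invariants (LieAlgebra.SpecialLinear.sl (Fin n) K) ∧
      IsDomain (GLInvariants.invariants (⊤ : LieSubalgebra K (Matrix (Fin n) (Fin n) K))) ∧
      UniqueFactorizationMonoid
        (GLInvariants.invariants (⊤ : LieSubalgebra K (Matrix (Fin n) (Fin n) K))) ∧
      ∀ f : GLInvariants.invariants (⊤ : LieSubalgebra K (Matrix (Fin n) (Fin n) K)),
        Irreducible f ↔
          (∃ g : GLInvariants.CoordRing K n, Irreducible g ∧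
              g ∉ GLInvariants.invariants (⊤ : LieSubalgebra K (Matrix (Fin n) (Fin n) K)) ∧
              (f : GLInvariants.CoordRing K n) = g ^ p) ∨
            Irreducible (f : GLInvariants.CoordRing K n) := by
  exact ⟨GLInvariants.invariants_top_eq_invariants_sl, inferInstance,
    GLInvariants.uniqueFactorizationMonoid_invariants_top p,
    GLInvariants.irreducible_iff_irreducible_or_pow_char p⟩
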